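/- Let $G$ be a finite simple graph and $p>0$ a real number. The *fractional brushing game* with parameter $p$ on $G$ is played by Min and Max. Initially every vertex is dirty and carries no brushes. The players alternate turns, Min first; on each turn the player adds one brush to a dirty vertex of his or her choice. Whenever the number of brushes on a dirty vertex $v$ is at least $p$ times the number of dirty neighbors of $v$, the vertex $v$ *fires*: it sends $p$ brushes to each of its dirty neighbors and becomes clean. Firings continue, one at a time, until no dirty vertex can fire (the order of the firings does not affect the resulting set of dirty vertices or the brushes on them); then the next turn is played. The game ends when all vertices are clean. Min wants to minimize, and Max to maximize, the number of turns played; the number of turns under optimal play by both is denoted $b_{g,p}(G)$. For $p=1$ this is the ordinary brushing game, and $b_g(G)=b_{g,1}(G)$ is the game brush number of $G$. Let $p=p(n)>0$ satisfy $p(n)\gg \ln n/n$, that is, $\dfrac{\ln n}{n\,p(n)}\to 0$ as $n\to\infty$. Then, for the complete graph $K_n$, as $n\to\infty$, $$b_{g,p(n)}(K_n)=(1+o(1))\,p(n)\,b_g(K_n)=(1+o(1))\,\frac{p(n)\,n^2}{e}.$$ -/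

import Mathlib

/-- The two players. -/
inductive Player where
  | min
  | max

/-- A position of a brushing game: the set of dirty vertices and the number of brushes on each
vertex (real, since in the fractional game vertices need not hold whole numbers of brushes). -/
structure BrushPosition (V : Type*) where
  dirty : Finset V
  brushes : V → ℝ

namespace BrushPosition

variable {V : Type*} [DecidableEq V]

/-- The dirty neighbours of `v`. -/
def dirtyNeighbors (G : SimpleGraph V) [DecidableRel G.Adj] (s : BrushPosition V) (v : V) :
    Finset V :=
  s.dirty.filter (fun w => G.Adj v w)

/-- A dirty vertex is ready to fire when the number of brushes on it is at least `p` times the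
number of its dirty neighbours. -/
def Ready (p : ℝ) (G : SimpleGraph V) [DecidableRel G.Adj] (s : BrushPosition V) (v : V) : Prop :=
  v ∈ s.dirty ∧ p * ((s.dirtyNeighbors G v).card : ℝ) ≤ s.brushes v

/-- The vertex `v` fires: it sends `p` brushes to each dirty neighbour and becomes clean. -/
def fire (p : ℝ) (G : SimpleGraph V) [DecidableRel G.Adj] (s : BrushPosition V) (v : V) :
    BrushPosition V where
  dirty := s.dirty.erase v
  brushes := fun w =>
    if w = v then s.brushes v - p * ((s.dirtyNeighbors G v).card : ℝ)
    else if w ∈ s.dirtyNeighbors G v then s.brushes w + p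
    else s.brushes w

open Classical in
/-- Vertices fire, one at a time, until no dirty vertex is ready.  The order of the firings, which
does not influence the final set of dirty vertices or the brushes on them, is fixed by choice. -/
noncomputable def stabilize (p : ℝ) (G : SimpleGraph V) [DecidableRel G.Adj]
    (s : BrushPosition V) : BrushPosition V :=
  if h : ∃ v, s.Ready p G v then stabilize p G (s.fire p G h.choose) else s
termination_by s.dirty.card
decreasing_by exact Finset.card_erase_lt_of_mem h.choose_spec.1

/-- Put one brush on `v`. -/
def place (s : BrushPosition V) (v : V) : BrushPosition V where
  dirty := s.dirty
  brushes := fun w => if w = v then s.brushes w + 1 else s.brushes w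

/-- A turn: a brush is put on `v`, then all firings that this causes take place. -/
noncomputable def move (p : ℝ) (G : SimpleGraph V) [DecidableRel G.Adj] (s : BrushPosition V)
    (v : V) : BrushPosition V :=
  (s.place v).stabilize p G

/-- The initial position: every vertex is dirty and there are no brushes (vertices that are ready
with no brush at all, that is, isolated vertices, fire at once). -/
noncomputable def start (p : ℝ) (G : SimpleGraph V) [Fintype V] [DecidableRel G.Adj] :
    BrushPosition V :=
  stabilize p G { dirty := Finset.univ, brushes := fun _ => 0 }

/-- `s.MinForces p G k P`: from the position `s` with player `P` to move, Min has a strategy by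
which the game, in which the players alternately put a brush on a dirty vertex of their choice,
ends (every vertex is clean) after at most `k` further turns, however Max plays. -/
def MinForces (p : ℝ) (G : SimpleGraph V) [DecidableRel G.Adj] :
    ℕ → Player → BrushPosition V → Prop
  | 0, _, s => s.dirty = ∅
  | k + 1, .min, s => s.dirty = ∅ ∨ ∃ v ∈ s.dirty, MinForces p G k .max (s.move p G v)
  | k + 1, .max, s => s.dirty = ∅ ∨ ∀ v ∈ s.dirty, MinForces p G k .min (s.move p G v)

end BrushPosition

/-- The length (number of brushes played) of the Min-start fractional brushing game with
parameter `p` on `G` under optimal play: the least `k` such that Min can force the end of the game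
within `k` turns.  For `p ≥ 0` such a `k` exists, see `exists_minForces_start`. -/
noncomputable def fractionalGameBrushNumber {V : Type*} [Fintype V] [DecidableEq V] (p : ℝ)
    (G : SimpleGraph V) [DecidableRel G.Adj] : ℕ :=
  sInf {k : ℕ | BrushPosition.MinForces p G k .min (BrushPosition.start p G)}

/-- The game brush number.  In the ordinary game a vertex fires when it has at least as many
brushes as dirty neighbours, and it then sends one brush to each: these are the rules for
`p = 1`. -/
noncomputable def gameBrushNumber {V : Type*} [Fintype V] [DecidableEq V]
    (G : SimpleGraph V) [DecidableRel G.Adj] : ℕ :=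
  fractionalGameBrushNumber 1 G

namespace BrushPosition

variable {V : Type*} [DecidableEq V]

theorem stabilize_spec (p : ℝ) (hp : 0 ≤ p) (G : SimpleGraph V) [DecidableRel G.Adj]
    (s : BrushPosition V) :
    (∀ v, ¬ (s.stabilize p G).Ready p G v) ∧ (s.stabilize p G).dirty ⊆ s.dirty ∧
      ∀ v ∈ (s.stabilize p G).dirty, s.brushes v ≤ (s.stabilize p G).brushes v := by
  induction hn : s.dirty.card using Nat.strong_induction_on generalizing s with
  | _ n ih =>
    subst hn
    rw [stabilize]
    split_ifs with h
    · have hlt := Finset.card_erase_lt_of_mem h.choose_spec.1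
      obtain ⟨h1, h2, h3⟩ := ih _ hlt (s.fire p G h.choose) rfl
      refine ⟨h1, h2.trans (Finset.erase_subset _ _), fun v hv => le_trans ?_ (h3 v hv)⟩
      have hne : v ≠ h.choose := Finset.ne_of_mem_erase (h2 hv)
      simp only [fire, if_neg hne]
      split_ifs <;> linarith
    · exact ⟨fun v hv => h ⟨v, hv⟩, subset_rfl, fun v _ => le_rfl⟩

/-- The game ends after boundedly many turns, whatever the players do. -/
theorem exists_minForces_start [Fintype V] (p : ℝ) (hp : 0 ≤ p) (G : SimpleGraph V)
    [DecidableRel G.Adj] : ∃ k, MinForces p G k .min (start p G) := by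
  let d : BrushPosition V → V → ℕ := fun s v => ⌈p * (Fintype.card V : ℝ) - s.brushes v⌉₊
  let Φ : BrushPosition V → ℕ := fun s => ∑ v ∈ s.dirty, d s v
  have hpos : ∀ s : BrushPosition V, (∀ v, ¬ s.Ready p G v) → ∀ v ∈ s.dirty,
      0 < p * (Fintype.card V : ℝ) - s.brushes v := by
    intro s hs v hv
    have h1 : s.brushes v < p * ((s.dirtyNeighbors G v).card : ℝ) := by
      by_contra hc
      exact hs v ⟨hv, not_lt.mp hc⟩
    have h2 : ((s.dirtyNeighbors G v).card : ℝ) ≤ Fintype.card V := by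
      exact_mod_cast Finset.card_le_univ _
    nlinarith [mul_le_mul_of_nonneg_left h2 hp]
  have hmove : ∀ s : BrushPosition V, (∀ v, ¬ s.Ready p G v) → ∀ v ∈ s.dirty,
      (∀ w, ¬ (s.move p G v).Ready p G w) ∧ Φ (s.move p G v) < Φ s := by
    intro s hs v hv
    obtain ⟨h1, h2, h3⟩ := stabilize_spec p hp G (s.place v)
    refine ⟨h1, ?_⟩
    have hle : Φ (s.move p G v) ≤ ∑ w ∈ s.dirty, d (s.place v) w := by
      refine le_trans (Finset.sum_le_sum fun w hw => ?_)
        (Finset.sum_le_sum_of_subset (f := d (s.place v)) h2)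
      exact Nat.ceil_mono (sub_le_sub_left (h3 w hw) _)
    refine lt_of_le_of_lt hle (Finset.sum_lt_sum (fun w _ => ?_) ⟨v, hv, ?_⟩)
    · refine Nat.ceil_mono ?_
      simp only [place]
      split_ifs <;> linarith
    · have hx := hpos s hs v hv
      have hd : 0 < d s v := Nat.ceil_pos.mpr hx
      have : d (s.place v) v ≤ d s v - 1 := by
        refine Nat.ceil_le.mpr ?_
        have hc : p * (Fintype.card V : ℝ) - s.brushes v ≤ (d s v : ℝ) := Nat.le_ceil _
        rw [Nat.cast_sub hd]
        simp only [place, if_true, Nat.cast_one]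
        linarith
      omega
  have key : ∀ k P (s : BrushPosition V), (∀ v, ¬ s.Ready p G v) → Φ s ≤ k →
      MinForces p G k P s := by
    intro k
    induction k with
    | zero =>
      intro P s hs hk
      rw [MinForces]
      by_contra hne
      obtain ⟨v, hv⟩ := Finset.nonempty_iff_ne_empty.mpr hne
      have := (hmove s hs v hv).2
      omega
    | succ k ih =>
      intro P s hs hk
      cases P with
      | min =>
        rw [MinForces]
        rcases s.dirty.eq_empty_or_nonempty with h | ⟨v, hv⟩
        · exact Or.inl h
        · have := hmove s hs v hv
          exact Or.inr ⟨v, hv, ih _ _ this.1 (by omega)⟩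
      | max =>
        rw [MinForces]
        refine Or.inr fun v hv => ?_
        have := hmove s hs v hv
        exact ih _ _ this.1 (by omega)
  exact ⟨_, key _ _ _ (stabilize_spec p hp G _).1 le_rfl⟩

end BrushPosition

/-! On a complete graph all dirty vertices have received the same number of brushes from firings. So
only the placed brushes (`own`) matter, and with `m` dirty vertices a vertex fires once it holds
`thr p n m = p(2m - 1 - n)` of them. Each side has an explicit strategy, and both strategies give `p
n² / e` up to lower order terms.

Lower bound: Max always plays on a dirty vertex with the fewest placed brushes. For every firing
order `σ` Min might aim for and every `q`, this keeps `pot` (brushes on the last `q` vertices plus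
the deficits of the others) above `potBound` after each Max move (`Inv.place_max`); firings preserve
this (`Inv.fire`). Hence many brushes lie on the dirty vertices when only `q` are left. Together
with the thresholds paid by the earlier firings, this forces about `2 p q² log (n / q)` turns
(`le_fractionalGameBrushNumber_top`). The best choice is `q ≈ n e^(-1/2)`.

Upper bound: Min picks a vertex of at least average height and plays on it until some firing occurs,
then picks again. The cost is governed by `val = p m² ψ(gap)`, where `ψ(z) = e^(-z) - 1 + z` solves
`ψ + ψ' = z`, the continuous limit of this strategy. Each target costs only `O(p + 1)` beyond `val`
(`valNext_le_val`, `val_fire_le`, `val_le_turnBound`), and initially the gap is at most `1`, with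
`ψ(1) = 1/e`.

The errors, linear in `n` with coefficients `O(p + 1)`, are negligible against `p n²` because `1/n`
and `1/(n p)` tend to `0`; the hypothesis on `p` enters only through the latter. The case `p = 1`
gives the comparison with `b_g`. -/

namespace BrushPosition

/-! ### Placed brushes and thresholds on a complete graph -/

section Complete

variable {V : Type*} [DecidableEq V]

/-- On a complete graph with `n` vertices, a dirty vertex is ready as soon as at least
`thr p n m` brushes have been placed on it by the players, where `m` is the number of dirty
vertices. -/
noncomputable def thr (p : ℝ) (n m : ℕ) : ℝ := p * (2 * m - 1 - n)

/-- The brushes on `v` that do not come from firings, if `v` is a dirty vertex of a complete graph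
with `n` vertices. -/
noncomputable def own (p : ℝ) (n : ℕ) (s : BrushPosition V) (v : V) : ℝ :=
  s.brushes v - p * (n - s.dirty.card)

/-- The total number of placed brushes on the dirty vertices. -/
noncomputable def total (p : ℝ) (n : ℕ) (s : BrushPosition V) : ℝ :=
  ∑ v ∈ s.dirty, own p n s v

theorem thr_mono {p : ℝ} (hp : 0 ≤ p) (n : ℕ) {i j : ℕ} (h : i ≤ j) : thr p n i ≤ thr p n j := by
  have : (i : ℝ) ≤ j := by exact_mod_cast h
  exact mul_le_mul_of_nonneg_left (by linarith) hp

variable {p : ℝ} {n : ℕ} {s : BrushPosition V} {v w : V}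

theorem own_place : own p n (s.place v) w = own p n s w + if w = v then 1 else 0 := by
  unfold own place
  dsimp only
  split_ifs <;> ring

theorem total_place (hv : v ∈ s.dirty) : total p n (s.place v) = total p n s + 1 := by
  unfold total
  simp only [own_place, Finset.sum_add_distrib]
  simp [place, hv]

/-- A property that is preserved by firings is preserved by stabilization. -/
theorem stabilize_induction {G : SimpleGraph V} [DecidableRel G.Adj] {C : BrushPosition V → Prop}
    (hstep : ∀ s v, C s → s.Ready p G v → C (s.fire p G v)) (s : BrushPosition V) (hs : C s) :
    C (s.stabilize p G) := by
  induction hn : s.dirty.card using Nat.strong_induction_on generalizing s with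
  | _ n ih =>
    subst hn
    rw [stabilize]
    split_ifs with h
    · exact ih _ (Finset.card_erase_lt_of_mem h.choose_spec.1) _ (hstep _ _ hs h.choose_spec) rfl
    · exact hs

variable [DecidableRel (⊤ : SimpleGraph V).Adj]

theorem dirtyNeighbors_top (s : BrushPosition V) (v : V) :
    s.dirtyNeighbors ⊤ v = s.dirty.erase v := by
  ext w
  simp [dirtyNeighbors, and_comm, eq_comm]

theorem ready_top_iff : s.Ready p ⊤ v ↔ v ∈ s.dirty ∧ thr p n s.dirty.card ≤ own p n s v := by
  unfold Ready
  refine and_congr_right fun hv => ?_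
  have h1 : 1 ≤ s.dirty.card := Finset.card_pos.mpr ⟨v, hv⟩
  rw [dirtyNeighbors_top, Finset.card_erase_of_mem hv, Nat.cast_sub h1]
  unfold thr own
  push_cast
  constructor <;> intro h <;> linarith

theorem card_dirty_fire (hv : v ∈ s.dirty) :
    (s.fire p ⊤ v).dirty.card + 1 = s.dirty.card :=
  Finset.card_erase_add_one hv

theorem own_fire (hv : v ∈ s.dirty) (hw : w ∈ (s.fire p ⊤ v).dirty) :
    own p n (s.fire p ⊤ v) w = own p n s w := by
  have h := card_dirty_fire (p := p) hv
  have h' : ((s.fire p ⊤ v).dirty.card : ℝ) = s.dirty.card - 1 := by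
    rw [← h]; push_cast; ring
  have hw' := Finset.mem_erase.mp hw
  unfold own
  rw [h']
  simp only [fire, dirtyNeighbors_top, if_neg hw'.1, if_pos (Finset.mem_erase.mpr hw')]
  ring

theorem total_fire (hv : v ∈ s.dirty) :
    total p n (s.fire p ⊤ v) = total p n s - own p n s v := by
  unfold total
  rw [Finset.sum_congr rfl fun w hw => own_fire hv hw, ← Finset.sum_erase_add _ _ hv]
  simp [fire]

end Complete

/-! ### Lower bound: the potential and its recursion -/

section Lower

variable {V : Type*}

/-- The contribution of a vertex with `x` placed brushes that is the `j`-th last one to fire to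
`pot`. -/
noncomputable def cst (p : ℝ) (n q j : ℕ) (x : ℝ) : ℝ :=
  if j ≤ q then x else max (thr p n j - x) 0

/-- If `σ` enumerates the vertices in the order in which Min makes them fire (last one first), then
`pot p n q σ D x` is the number of brushes on the last `q` vertices, plus the number of brushes
which Min needs to make the other vertices of `D` fire. -/
noncomputable def pot (p : ℝ) (n q : ℕ) (σ : V → ℕ) (D : Finset V) (x : V → ℝ) : ℝ :=
  ∑ v ∈ D, cst p n q (σ v) (x v)

/-- The lower bound for `pot` that Max can maintain. -/
noncomputable def potBound (p : ℝ) (n q : ℕ) : ℝ :=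
  q * (q + 1) * ∑ l ∈ Finset.Ioc q n, (thr p n l - 2) / (l * (l + 1))

variable {p : ℝ} {n q : ℕ} {σ : V → ℕ} {D : Finset V} {x : V → ℝ}

theorem potBound_self (p : ℝ) (n : ℕ) : potBound p n n = 0 := by simp [potBound]

/-- The recursion behind the definition of `potBound`: divided by `q(q+1)(q+2)`, for `q > 0`, it
telescopes. It is exactly the inequality obtained in `potBound_le_of_succ`, taken with equality. -/
theorem potBound_succ (h : q < n) :
    (q + 2) * potBound p n q = q * (potBound p n (q + 1) + thr p n (q + 1) - 2) := by
  have h1 : Finset.Ioc q n = insert (q + 1) (Finset.Ioc (q + 1) n) := by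
    ext l; simp only [Finset.mem_Ioc, Finset.mem_insert]; omega
  unfold potBound
  rw [h1, Finset.sum_insert (by simp)]
  push_cast
  have h2 : (q : ℝ) + 1 ≠ 0 := by positivity
  have h3 : (q : ℝ) + 1 + 1 ≠ 0 := by positivity
  field_simp
  ring

theorem sum_comp_of_bijOn (hσ : Set.BijOn σ D (Set.Icc 1 D.card)) (g : ℕ → ℝ) :
    ∑ v ∈ D, g (σ v) = ∑ j ∈ Finset.Icc 1 D.card, g j := by
  refine Finset.sum_nbij σ (fun v hv => ?_) hσ.injOn ?_ fun _ _ => rfl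
  · simpa using hσ.mapsTo hv
  · simpa using hσ.surjOn

theorem mul_le_pot (hσ : Set.BijOn σ D (Set.Icc 1 D.card)) (hq : q ≤ D.card) {L : ℝ}
    (hL : ∀ v ∈ D, L ≤ x v) : q * L ≤ pot p n q σ D x := by
  have h1 : ∑ v ∈ D, (if σ v ≤ q then L else 0) ≤ pot p n q σ D x := by
    refine Finset.sum_le_sum fun v hv => ?_
    unfold cst
    split_ifs
    · exact hL v hv
    · exact le_max_right _ _
  have h2 : (Finset.Icc 1 D.card).filter (fun j => j ≤ q) = Finset.Icc 1 q := by
    ext j; simp only [Finset.mem_filter, Finset.mem_Icc]; omega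
  rw [sum_comp_of_bijOn hσ fun j => if j ≤ q then L else 0, ← Finset.sum_filter, h2] at h1
  simpa using h1

theorem pot_card (hσ : Set.BijOn σ D (Set.Icc 1 D.card)) :
    pot p n D.card σ D x = ∑ v ∈ D, x v :=
  Finset.sum_congr rfl fun v hv => by simp [cst, (hσ.mapsTo hv).2]

variable [DecidableEq V]

theorem pot_eq_succ (hσ : Set.BijOn σ D (Set.Icc 1 D.card)) {a : V} (ha : a ∈ D)
    (haq : σ a = q + 1) :
    pot p n q σ D x = pot p n (q + 1) σ D x - x a + max (thr p n (q + 1) - x a) 0 := by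
  unfold pot
  rw [← Finset.sum_erase_add _ _ ha,
    ← Finset.sum_erase_add _ (fun v => cst p n (q + 1) (σ v) (x v)) ha]
  have : ∑ v ∈ D.erase a, cst p n q (σ v) (x v) = ∑ v ∈ D.erase a, cst p n (q + 1) (σ v) (x v) := by
    refine Finset.sum_congr rfl fun v hv => ?_
    have hv' := Finset.mem_erase.mp hv
    have hne : σ v ≠ q + 1 := fun h => hv'.1 (hσ.injOn hv'.2 ha (h.trans haq.symm))
    unfold cst
    have : σ v ≤ q ↔ σ v ≤ q + 1 := by omega
    simp only [this]
  rw [this]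
  simp [cst, haq]

/-- If the vertex in position `q + 1` has at most one brush more than any other vertex, the bound
for `q + 1` implies that for `q`. -/
theorem potBound_le_of_succ (hσ : Set.BijOn σ D (Set.Icc 1 D.card)) (hqn : q < n) {a : V}
    (ha : a ∈ D) (haq : σ a = q + 1) {L : ℝ} (hL : ∀ v ∈ D, L ≤ x v) (hxa : x a ≤ L + 1)
    (h : potBound p n (q + 1) ≤ pot p n (q + 1) σ D x) :
    potBound p n q ≤ pot p n q σ D x := by
  have hq : q ≤ D.card := by
    have := (hσ.mapsTo ha).2
    omega
  have h1 := mul_le_pot (p := p) (n := n) hσ hq hL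
  have h2 := pot_eq_succ (p := p) (n := n) (x := x) hσ ha haq
  have h3 := le_max_left (thr p n (q + 1) - x a) 0
  have h4 := potBound_succ (p := p) hqn
  have hq0 : (0 : ℝ) ≤ q := by positivity
  -- Passing from `q + 1` to `q` changes `pot` by at least `thr - 2 x a ≥ thr - 2 L - 2`. After
  -- multiplication by `q`, the term `2 q L` is absorbed by `2 pot`, since `q L ≤ pot`; hence the
  -- factor `q + 2`.
  have h5 : potBound p n (q + 1) + thr p n (q + 1) - 2 ≤ pot p n q σ D x + 2 * L := by linarith
  have h6 := mul_le_mul_of_nonneg_left h5 hq0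
  have h7 : (q + 2) * potBound p n q ≤ (q + 2) * pot p n q σ D x := by linarith
  exact le_of_mul_le_mul_left h7 (by positivity)

theorem bijOn_comp_swap (hσ : Set.BijOn σ D (Set.Icc 1 D.card)) {a w : V} (ha : a ∈ D)
    (hw : w ∈ D) : Set.BijOn (σ ∘ Equiv.swap a w) D (Set.Icc 1 D.card) := by
  refine hσ.comp ?_
  have hm : Set.MapsTo (Equiv.swap a w) (D : Set V) D := by
    intro v hv
    by_cases h1 : v = a
    · simpa [h1] using hw
    · by_cases h2 : v = w
      · simpa [h2] using ha
      · rwa [Equiv.swap_apply_of_ne_of_ne h1 h2]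
  exact ⟨hm, (Equiv.injective _).injOn, fun v hv => ⟨_, hm hv, Equiv.swap_apply_self a w v⟩⟩

/-- Firing vertices with more brushes earlier is cheaper. -/
theorem pot_comp_swap_le (hp : 0 ≤ p) {a w : V} (ha : a ∈ D) (hw : w ∈ D) (hx : x w ≤ x a)
    (hqa : q < σ a) (haw : σ a ≤ σ w) :
    pot p n q (σ ∘ Equiv.swap a w) D x ≤ pot p n q σ D x := by
  rcases eq_or_ne a w with rfl | hne
  · simp
  have hw' : w ∈ D.erase a := Finset.mem_erase.mpr ⟨hne.symm, hw⟩
  unfold pot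
  rw [← Finset.sum_erase_add _ _ ha, ← Finset.sum_erase_add _ _ hw',
    ← Finset.sum_erase_add _ (fun v => cst p n q (σ v) (x v)) ha,
    ← Finset.sum_erase_add _ (fun v => cst p n q (σ v) (x v)) hw']
  have h1 : ∑ v ∈ (D.erase a).erase w, cst p n q ((σ ∘ Equiv.swap a w) v) (x v) =
      ∑ v ∈ (D.erase a).erase w, cst p n q (σ v) (x v) := by
    refine Finset.sum_congr rfl fun v hv => ?_
    simp only [Finset.mem_erase] at hv
    rw [Function.comp_apply, Equiv.swap_apply_of_ne_of_ne hv.2.1 hv.1]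
  rw [h1]
  simp only [Function.comp_apply, Equiv.swap_apply_left, Equiv.swap_apply_right, cst,
    if_neg (not_le.mpr hqa), if_neg (not_le.mpr (hqa.trans_le haw))]
  have h2 := thr_mono hp n haw
  rcases max_cases (thr p n (σ a) - x w) 0 with h3 | h3 <;>
  rcases max_cases (thr p n (σ a) - x a) 0 with h4 | h4 <;>
  rcases max_cases (thr p n (σ w) - x w) 0 with h5 | h5 <;>
  rcases max_cases (thr p n (σ w) - x a) 0 with h6 | h6 <;> linarith

/-! ### Max's strategy maintains the invariant -/

/-- For every plan of Min, `pot` is at least `potBound`, up to `c`. -/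
def Inv (p : ℝ) (n : ℕ) (c : ℝ) (s : BrushPosition V) : Prop :=
  ∀ σ : V → ℕ, Set.BijOn σ s.dirty (Set.Icc 1 s.dirty.card) → ∀ q ≤ s.dirty.card,
    potBound p n q - c ≤ pot p n q σ s.dirty (own p n s)

/-- One brush lowers one deficit by at most one and lowers no other term of `pot`. -/
theorem Inv.place_min {s : BrushPosition V} (h : Inv p n 0 s) (v : V) :
    Inv p n 1 (s.place v) := by
  intro σ hσ q hq
  have h1 := h σ hσ q hq
  have h2 : pot p n q σ s.dirty (own p n s) - 1 ≤ pot p n q σ s.dirty (own p n (s.place v)) := by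
    have h3 : pot p n q σ s.dirty (own p n s) ≤ ∑ w ∈ s.dirty,
        (cst p n q (σ w) (own p n (s.place v) w) + if w = v then 1 else 0) := by
      refine Finset.sum_le_sum fun w _ => ?_
      rw [own_place]
      unfold cst
      split_ifs
      · linarith
      · linarith
      · rcases max_cases (thr p n (σ w) - own p n s w) 0 with h4 | h4 <;>
        rcases max_cases (thr p n (σ w) - (own p n s w + 1)) 0 with h5 | h5 <;> linarith
      · simp
    rw [Finset.sum_add_distrib, Finset.sum_ite_eq'] at h3
    unfold pot at *
    split_ifs at h3 <;> linarith
  change _ ≤ pot p n q σ s.dirty (own p n (s.place v))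
  linarith

/-- If the lowest vertex `w` is among the last `q`, its new brush restores the unit lost to Min.
Otherwise the bound is inherited from `q + 1`, after moving `w` to position `q + 1` if the vertex
there is too high. At `q = card` the potential is the total, which every brush raises. -/
theorem Inv.place_max (hp : 0 ≤ p) {s : BrushPosition V} (h : Inv p n 1 s)
    (hn : s.dirty.card ≤ n) {w : V} (hw : w ∈ s.dirty)
    (hmin : ∀ v ∈ s.dirty, own p n s w ≤ own p n s v) : Inv p n 0 (s.place w) := by
  have hL : ∀ v ∈ s.dirty, own p n s w ≤ own p n (s.place w) v := by
    intro v hv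
    have := hmin v hv
    rw [own_place]
    split_ifs <;> linarith
  have hxw : own p n (s.place w) w = own p n s w + 1 := by simp [own_place]
  -- Downward induction on `q`; `σ` stays universally quantified because the swap changes the order.
  suffices H : ∀ d q, q + d = s.dirty.card → ∀ σ : V → ℕ,
      Set.BijOn σ s.dirty (Set.Icc 1 s.dirty.card) →
      potBound p n q ≤ pot p n q σ s.dirty (own p n (s.place w)) by
    intro σ hσ q hq
    rw [sub_zero]
    obtain ⟨d, hd⟩ := Nat.exists_eq_add_of_le hq
    exact H d q hd.symm σ hσ
  intro d
  induction d with
  | zero =>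
    intro q hq σ hσ
    have hq' : q = s.dirty.card := hq
    subst hq'
    have h1 := h σ hσ _ le_rfl
    rw [pot_card hσ] at h1 ⊢
    have h2 := total_place (p := p) (n := n) hw
    unfold total at h2
    change ∑ v ∈ s.dirty, own p n (s.place w) v = _ at h2
    linarith
  | succ d ih =>
    intro q hq σ hσ
    by_cases hwq : σ w ≤ q
    · have h1 := h σ hσ q (by omega)
      have h2 : pot p n q σ s.dirty (own p n (s.place w)) =
          pot p n q σ s.dirty (own p n s) + 1 := by
        unfold pot
        rw [← Finset.sum_erase_add _ _ hw,
          ← Finset.sum_erase_add _ (fun v => cst p n q (σ v) (own p n s v)) hw]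
        have : ∑ v ∈ s.dirty.erase w, cst p n q (σ v) (own p n (s.place w) v) =
            ∑ v ∈ s.dirty.erase w, cst p n q (σ v) (own p n s v) :=
          Finset.sum_congr rfl fun v hv => by
            rw [own_place, if_neg (Finset.ne_of_mem_erase hv), add_zero]
        rw [this]
        simp only [cst, if_pos hwq, hxw]
        ring
      linarith
    · obtain ⟨a, ha, haq⟩ := hσ.surjOn (show q + 1 ∈ Set.Icc 1 s.dirty.card from
        ⟨by omega, by omega⟩)
      rcases le_total (own p n (s.place w) a) (own p n s w + 1) with hxa | hxa
      · exact potBound_le_of_succ hσ (by omega) ha haq hL hxa (ih _ (by omega) σ hσ)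
      -- Here `a` holds more than `w` and would fire later than it could: giving `w` position `q +
      -- 1` only lowers `pot`, and `w` is low enough for the recursion.
      · have hσ' := bijOn_comp_swap hσ ha hw
        refine le_trans ?_ (pot_comp_swap_le hp ha hw (by rw [hxw]; exact hxa) (by omega)
          (by omega))
        exact potBound_le_of_succ hσ' (by omega) hw (by simp [haq]) hL hxw.le
          (ih _ (by omega) _ hσ')

theorem Inv.of_brushes_eq_zero (D : Finset V) (hn : D.card = n) :
    Inv p n 0 { dirty := D, brushes := fun _ => 0 } := by
  have hown : ∀ v, own p n { dirty := D, brushes := fun _ => 0 } v = 0 := by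
    intro v; simp [own, hn]
  suffices H : ∀ σ : V → ℕ, Set.BijOn σ D (Set.Icc 1 D.card) → ∀ d q, q + d = D.card →
      potBound p n q ≤ pot p n q σ D (own p n { dirty := D, brushes := fun _ => 0 }) by
    intro σ hσ q hq
    rw [sub_zero]
    obtain ⟨d, hd⟩ := Nat.exists_eq_add_of_le hq
    exact H σ hσ d q hd.symm
  intro σ hσ d
  induction d with
  | zero =>
    intro q hq
    have hq' : q = D.card := hq
    subst hq'
    rw [pot_card hσ, hn, potBound_self]
    simp [hown]
  | succ d ih =>
    intro q hq
    obtain ⟨a, ha, haq⟩ := hσ.surjOn (show q + 1 ∈ Set.Icc 1 D.card from ⟨by omega, by omega⟩)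
    exact potBound_le_of_succ hσ (by omega) ha haq (L := 0) (fun v _ => (hown v).ge)
      (by rw [hown]; norm_num) (ih _ (by omega))

variable [DecidableRel (⊤ : SimpleGraph V).Adj]

/-- An order on the remaining vertices extends to one in which `v` fires first. As `v` has reached
its threshold, its deficit is zero and `pot` is unchanged. -/
theorem Inv.fire {c : ℝ} {s : BrushPosition V} (h : Inv p n c s) {v : V}
    (hv : s.Ready p ⊤ v) : Inv p n c (s.fire p ⊤ v) := by
  intro σ hσ q hq
  obtain ⟨hvd, hvt⟩ := (ready_top_iff (n := n)).mp hv
  have hcard := card_dirty_fire (p := p) hvd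
  set m := (s.fire p ⊤ v).dirty.card with hm
  have hdirty : (s.fire p ⊤ v).dirty = s.dirty.erase v := rfl
  have hupd : ∀ w ∈ s.dirty.erase v, Function.update σ v (m + 1) w = σ w := fun w hw =>
    Function.update_of_ne (Finset.ne_of_mem_erase hw) _ _
  have hbij : Set.BijOn (Function.update σ v (m + 1)) s.dirty (Set.Icc 1 s.dirty.card) := by
    rw [← hcard]
    have h1 : Set.BijOn (Function.update σ v (m + 1)) (s.dirty.erase v : Finset V)
        (Set.Icc 1 m) := hσ.congr fun w hw => (hupd w hw).symm
    have h2 := h1.insert (a := v) (by simp)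
    rw [← Finset.coe_insert, Finset.insert_erase hvd] at h2
    convert h2 using 1
    ext j
    simp only [Set.mem_Icc, Function.update_self, Set.mem_insert_iff]
    omega
  have h1 := h _ hbij q (by omega)
  refine h1.trans (le_of_eq ?_)
  unfold pot
  rw [← Finset.sum_erase_add _ _ hvd, hdirty]
  rw [← hcard] at hvt
  have h2 : cst p n q (Function.update σ v (m + 1) v) (own p n s v) = 0 := by
    simp only [Function.update_self, cst, if_neg (show ¬ m + 1 ≤ q by omega)]
    exact max_eq_right (by linarith)
  rw [h2, add_zero]
  exact Finset.sum_congr rfl fun w hw => by rw [hupd w hw, own_fire hvd hw]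

/-! ### Counting turns until `q` vertices are left -/

/-- The part of the total that remains when the number of dirty vertices goes down to `q`. -/
noncomputable def remainder (p : ℝ) (n q : ℕ) (s : BrushPosition V) : ℝ :=
  total p n s - ∑ l ∈ Finset.Ioc q s.dirty.card, thr p n l

/-- Each turn adds one to `remainder`, and a firing above level `q` cannot raise it, as it removes
at least the threshold. At level `q` the remainder is the total, which `Inv` bounds from below. -/
theorem le_add_remainder_of_minForces (hp : 0 ≤ p) (hq : 1 ≤ q) :
    ∀ (k : ℕ) (P : Player) (s : BrushPosition V),
      (match P with | .min => Inv p n 0 s | .max => Inv p n 1 s) → s.dirty.card ≤ n →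
      q ≤ s.dirty.card → MinForces p ⊤ k P (s.stabilize p ⊤) →
      potBound p n q - 1 ≤ k + remainder p n q s := by
  -- A cascade of firings may pass through level `q`. The alternative in the conclusion records the
  -- bound at the moment a position with `q` dirty vertices is about to fire again.
  have hstab : ∀ (c : ℝ) (s : BrushPosition V), c ≤ 1 → Inv p n c s → s.dirty.card ≤ n →
      q ≤ s.dirty.card → (q ≤ (s.stabilize p ⊤).dirty.card ∧ (s.stabilize p ⊤).dirty.card ≤ n ∧
        Inv p n c (s.stabilize p ⊤) ∧ remainder p n q (s.stabilize p ⊤) ≤ remainder p n q s) ∨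
        potBound p n q - 1 ≤ remainder p n q s := by
    intro c s hc hs hn hqs
    refine stabilize_induction (C := fun s' => (q ≤ s'.dirty.card ∧ s'.dirty.card ≤ n ∧
        Inv p n c s' ∧ remainder p n q s' ≤ remainder p n q s) ∨
        potBound p n q - 1 ≤ remainder p n q s) ?_ s (Or.inl ⟨hqs, hn, hs, le_rfl⟩)
    rintro s' v (⟨h1, h2, h3, h4⟩ | h) hv
    · rcases h1.eq_or_lt with h1 | h1
      · right
        obtain ⟨σ, hσ⟩ : ∃ σ : V → ℕ, Set.BijOn σ s'.dirty (Set.Icc 1 s'.dirty.card) := by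
          obtain ⟨e⟩ : Nonempty (s'.dirty ≃ Finset.Icc 1 s'.dirty.card) :=
            ⟨Finset.equivOfCardEq (by simp)⟩
          refine ⟨fun v => if h : v ∈ s'.dirty then e ⟨v, h⟩ else 0, ?_, ?_, ?_⟩
          · intro v hv
            have := Finset.mem_Icc.mp (e ⟨v, hv⟩).2
            simpa only [Finset.mem_coe.mp hv, dite_true, Set.mem_Icc] using this
          · intro v hv w hw hvw
            simpa [Finset.mem_coe.mp hv, Finset.mem_coe.mp hw, Subtype.ext_iff] using hvw
          · intro j hj
            have hj' : j ∈ Finset.Icc 1 s'.dirty.card := by simpa using hj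
            exact ⟨e.symm ⟨j, hj'⟩, (e.symm ⟨j, hj'⟩).2, by simp⟩
        have h5 := h3 σ hσ _ le_rfl
        rw [pot_card hσ, ← h1] at h5
        have h6 : remainder p n q s' = ∑ v ∈ s'.dirty, own p n s' v := by
          simp [remainder, total, ← h1]
        linarith
      · left
        obtain ⟨hvd, hvt⟩ := (ready_top_iff (n := n)).mp hv
        have hcard := card_dirty_fire (p := p) hvd
        refine ⟨by omega, by omega, h3.fire hv, le_trans ?_ h4⟩
        unfold remainder
        rw [total_fire hvd]
        rw [← hcard] at hvt ⊢
        rw [← Finset.insert_Ioc_right_eq_Ioc_add_one (by omega), Finset.sum_insert (by simp)]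
        linarith
    · exact Or.inr h
  intro k
  induction k with
  | zero =>
    intro P s hs hn hqs hk
    have hs1 : ∃ c : ℝ, c ≤ 1 ∧ Inv p n c s := by
      cases P
      · exact ⟨0, by norm_num, hs⟩
      · exact ⟨1, le_rfl, hs⟩
    obtain ⟨c, hc, hs1⟩ := hs1
    rcases hstab c s hc hs1 hn hqs with h | h
    · rw [MinForces] at hk
      rw [hk] at h
      simp at h
      omega
    · simpa using h
  | succ k ih =>
    intro P s hs hn hqs hk
    have hk0 : (0 : ℝ) ≤ k := by positivity
    push_cast
    cases P with
    | min =>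
      rcases hstab 0 s (by norm_num) hs hn hqs with ⟨h1, h2, h3, h4⟩ | h
      · rw [MinForces] at hk
        rcases hk with hk | ⟨v, hv, hk⟩
        · rw [hk] at h1
          simp at h1
          omega
        · have h5 := ih .max _ (h3.place_min v) h2 h1 hk
          have h6 : remainder p n q ((s.stabilize p ⊤).place v) =
              remainder p n q (s.stabilize p ⊤) + 1 := by
            unfold remainder
            rw [total_place hv]
            simp only [place]
            ring
          linarith
      · linarith
    | max =>
      rcases hstab 1 s le_rfl hs hn hqs with ⟨h1, h2, h3, h4⟩ | h
      · rw [MinForces] at hk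
        rcases hk with hk | hk
        · rw [hk] at h1
          simp at h1
          omega
        · obtain ⟨v, hv, hmin⟩ := Finset.exists_min_image (s.stabilize p ⊤).dirty
            (own p n (s.stabilize p ⊤)) (Finset.card_pos.mp (by omega))
          have h5 := ih .min _ (h3.place_max hp h2 hv hmin) h2 h1 (hk v hv)
          have h6 : remainder p n q ((s.stabilize p ⊤).place v) =
              remainder p n q (s.stabilize p ⊤) + 1 := by
            unfold remainder
            rw [total_place hv]
            simp only [place]
            ring
          linarith
      · linarith

/-! ### Explicit form of the lower bound -/

theorem sum_thr (p : ℝ) {n q : ℕ} (hqn : q ≤ n) :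
    ∑ l ∈ Finset.Ioc q n, thr p n l = p * (q * (n - q)) := by
  have : ∀ m, q ≤ m → ∑ l ∈ Finset.Ioc q m, thr p n l = p * ((m - q) * (m + q - n)) := by
    intro m hm
    induction m, hm using Nat.le_induction with
    | base => simp
    | succ m hm ih =>
      rw [← Finset.insert_Ioc_right_eq_Ioc_add_one hm, Finset.sum_insert (by simp), ih]
      unfold thr
      push_cast
      ring
  rw [this n hqn]
  ring

/-- In partial fractions each summand is `2p/(l+1) - (p(n+1)+2)(1/l - 1/(l+1))`: the second part
telescopes and the first is compared with a logarithm. -/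
theorem le_potBound (hp : 0 ≤ p) (hqn : q ≤ n) :
    q * (q + 1) * (2 * p * Real.log ((n + 2) / (q + 2)) -
      (p * (n + 1) + 2) * (1 / (q + 1) - 1 / (n + 1))) ≤ potBound p n q := by
  unfold potBound
  refine mul_le_mul_of_nonneg_left ?_ (by positivity)
  have : ∀ m, q ≤ m → 2 * p * Real.log ((m + 2) / (q + 2)) -
      (p * (n + 1) + 2) * (1 / (q + 1) - 1 / (m + 1)) ≤
      ∑ l ∈ Finset.Ioc q m, (thr p n l - 2) / (l * (l + 1)) := by
    intro m hm
    induction m, hm using Nat.le_induction with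
    | base =>
      have : (q : ℝ) + 2 ≠ 0 := by positivity
      simp [div_self this]
    | succ m hm ih =>
      rw [← Finset.insert_Ioc_right_eq_Ioc_add_one hm, Finset.sum_insert (by simp)]
      have h1 : Real.log (((m + 1 : ℕ) + 2) / (q + 2)) ≤
          Real.log ((m + 2) / (q + 2)) + 1 / (m + 2) := by
        have h2 : (((m + 1 : ℕ) : ℝ) + 2) / (q + 2) =
            ((m + 2) / (q + 2)) * (1 + 1 / (m + 2)) := by
          push_cast
          field_simp
          ring
        rw [h2, Real.log_mul (by positivity) (by positivity)]
        have := Real.log_le_sub_one_of_pos (show (0 : ℝ) < 1 + 1 / (m + 2) by positivity)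
        linarith
      have h3 : (thr p n (m + 1) - 2) / ((m + 1 : ℕ) * ((m + 1 : ℕ) + 1)) = 2 * p * (1 / (m + 2)) -
          (p * (n + 1) + 2) * (1 / (m + 1) - 1 / ((m + 1 : ℕ) + 1)) := by
        unfold thr
        push_cast
        have : (m : ℝ) + 1 + 1 ≠ 0 := by positivity
        have : (m : ℝ) + 1 + 1 = m + 2 := by ring
        rw [this]
        field_simp
        ring
      rw [h3]
      have := mul_le_mul_of_nonneg_left h1 (show 0 ≤ 2 * p by positivity)
      linarith
  exact this n hqn

theorem le_fractionalGameBrushNumber_top [Fintype V] (hp : 0 ≤ p) (hn : Fintype.card V = n)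
    (hq : 1 ≤ q) (hqn : q ≤ n) :
    2 * p * (q * (q + 1)) * Real.log ((n + 2) / (q + 2)) - 2 * n - 1 ≤
      fractionalGameBrushNumber p (⊤ : SimpleGraph V) := by
  have hforce : MinForces p ⊤ (fractionalGameBrushNumber p (⊤ : SimpleGraph V)) .min
      (start p (⊤ : SimpleGraph V)) := Nat.sInf_mem (exists_minForces_start p hp (⊤ : SimpleGraph V))
  have hcard : (Finset.univ : Finset V).card = n := hn
  have h1 := le_add_remainder_of_minForces hp hq _ .min _ (Inv.of_brushes_eq_zero Finset.univ hcard)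
    hcard.le (by simpa [hn] using hqn) hforce
  have h2 : remainder p n q { dirty := (Finset.univ : Finset V), brushes := fun _ => 0 } =
      - (p * (q * (n - q))) := by
    unfold remainder total own
    simp [hn, sum_thr p hqn]
  rw [h2] at h1
  have h3 := le_potBound hp hqn
  -- The telescoped term with `p(n+1)` equals `p q (n - q)` and cancels the sum of the thresholds;
  -- only the contribution of the `2` survives.
  have h4 : (q : ℝ) * (q + 1) * (2 * p * Real.log ((n + 2) / (q + 2)) -
      (p * (n + 1) + 2) * (1 / (q + 1) - 1 / (n + 1))) + p * (q * (n - q)) =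
      2 * p * (q * (q + 1)) * Real.log ((n + 2) / (q + 2)) - 2 * (q * ((n - q) / (n + 1))) := by
    field_simp
    ring
  have h5 : (q : ℝ) * ((n - q) / (n + 1)) ≤ n := by
    have hqn' : (q : ℝ) ≤ n := by exact_mod_cast hqn
    have h6 : ((n : ℝ) - q) / (n + 1) ≤ 1 := by
      rw [div_le_one (by positivity)]
      have : (0 : ℝ) ≤ q := by positivity
      linarith
    nlinarith [show (0 : ℝ) ≤ q by positivity]
  linarith

end Lower

end BrushPosition

namespace BrushPosition

/-! ### Upper bound: the function `ψ` -/

section Upper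

/-- The value function of the rescaled game. -/
noncomputable def psi (z : ℝ) : ℝ := Real.exp (-z) - 1 + z

theorem psi_nonneg (z : ℝ) : 0 ≤ psi z := by
  have := Real.add_one_le_exp (-z)
  unfold psi
  linarith

theorem psi_mono {y z : ℝ} (hy : 0 ≤ y) (hyz : y ≤ z) : psi y ≤ psi z := by
  have h1 := Real.add_one_le_exp (-(z - y))
  have h2 : Real.exp (-z) = Real.exp (-(z - y)) * Real.exp (-y) := by
    rw [← Real.exp_add]; congr 1; ring
  have h3 : Real.exp (-y) ≤ 1 := Real.exp_le_one_iff.mpr (by linarith)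
  have h4 := Real.exp_pos (-y)
  unfold psi
  rw [h2]
  nlinarith

theorem psi_sub_le {y z : ℝ} (hyz : y ≤ z) : psi z - psi y ≤ z - y := by
  have := Real.exp_le_exp.mpr (neg_le_neg hyz)
  unfold psi
  linarith

theorem exp_neg_sub_exp_neg_le {y z : ℝ} (hy : 0 ≤ y) (hyz : y ≤ z) :
    Real.exp (-y) - Real.exp (-z) ≤ z - y := by
  have := psi_mono hy hyz
  unfold psi at this
  linarith

/-- A second order Taylor estimate. -/
theorem psi_add_le {z δ : ℝ} (hz : 0 ≤ z) (hzδ : 0 ≤ z + δ) :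
    psi (z + δ) ≤ psi z + δ * (1 - Real.exp (-z)) + δ ^ 2 := by
  have h1 : Real.exp (-(z + δ)) * (1 + δ) ≤ Real.exp (-z) := by
    have h2 : Real.exp (-z) = Real.exp (-(z + δ)) * Real.exp δ := by
      rw [← Real.exp_add]; congr 1; ring
    rw [h2]
    have := Real.add_one_le_exp δ
    exact mul_le_mul_of_nonneg_left (by linarith) (Real.exp_pos _).le
  have h3 : δ * (Real.exp (-z) - Real.exp (-(z + δ))) ≤ δ ^ 2 := by
    rcases le_total 0 δ with h | h
    · have := exp_neg_sub_exp_neg_le hz (show z ≤ z + δ by linarith)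
      nlinarith
    · have := exp_neg_sub_exp_neg_le hzδ (show z + δ ≤ z by linarith)
      nlinarith
  unfold psi
  nlinarith

theorem psi_le_sq {z : ℝ} (hz : 0 ≤ z) : psi z ≤ z ^ 2 := by
  have := psi_add_le le_rfl (show 0 ≤ 0 + z by linarith)
  simpa [psi] using this

/-! ### Value estimates for raising and firing a vertex -/

/-- The rescaled distance of the average number of placed brushes to the threshold. -/
noncomputable def gap (p : ℝ) (n m : ℕ) (S : ℝ) : ℝ := (thr p n m - S / m) / (p * m)

/-- Up to lower order terms, the number of remaining turns when there are `m` dirty vertices with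
`S` placed brushes in total. -/
noncomputable def val (p : ℝ) (n m : ℕ) (S : ℝ) : ℝ := p * m ^ 2 * psi (max (gap p n m S) 0)

/-- Up to lower order terms, the number of remaining turns when there are `m` dirty vertices with
`S` placed brushes in total, `x` of them on the vertex which Min makes fire next. -/
noncomputable def valNext (p : ℝ) (n m : ℕ) (S x : ℝ) : ℝ :=
  2 * (thr p n m - x) + val p n (m - 1) (S + thr p n m - 2 * x)

variable {p : ℝ} {n m : ℕ} {S : ℝ}

theorem val_nonneg (hp : 0 < p) : 0 ≤ val p n m S :=
  mul_nonneg (by positivity) (psi_nonneg _)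

theorem gap_anti (hp : 0 < p) {R : ℝ} (h : S ≤ R) : gap p n m R ≤ gap p n m S := by
  unfold gap
  gcongr

theorem val_anti (hp : 0 < p) {R : ℝ} (h : S ≤ R) : val p n m R ≤ val p n m S :=
  mul_le_mul_of_nonneg_left
    (psi_mono (le_max_right _ _) (max_le_max_right _ (gap_anti hp h))) (by positivity)

/-- `ψ` has slope at most one and `p m² · gap` changes by exactly `R - S`, so a brush saves at most
one turn. -/
theorem val_le_add (hp : 0 < p) {R : ℝ} (h : S ≤ R) :
    val p n m S ≤ val p n m R + (R - S) := by
  rcases Nat.eq_zero_or_pos m with rfl | hm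
  · simp [val]; exact h
  have hm' : (0 : ℝ) < m := by exact_mod_cast hm
  have h1 := psi_sub_le (max_le_max_right 0 (gap_anti (n := n) (m := m) hp h))
  have h2 : max (gap p n m S) 0 - max (gap p n m R) 0 ≤ gap p n m S - gap p n m R := by
    have := gap_anti (n := n) (m := m) hp h
    rcases max_cases (gap p n m S) 0 with h3 | h3 <;>
    rcases max_cases (gap p n m R) 0 with h4 | h4 <;> linarith
  have h5 : p * m ^ 2 * (gap p n m S - gap p n m R) = R - S := by
    unfold gap
    field_simp
    ring
  have h6 := mul_le_mul_of_nonneg_left (h1.trans h2) (show 0 ≤ p * (m : ℝ) ^ 2 by positivity)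
  rw [h5] at h6
  unfold val
  linarith

/-- `valNext` decreases in the number of brushes on the vertex that fires next. -/
theorem valNext_anti (hp : 0 < p) {x y : ℝ} (h : x ≤ y) :
    valNext p n m S y ≤ valNext p n m S x := by
  have := val_le_add (n := n) (m := m - 1) hp
    (show S + thr p n m - 2 * y ≤ S + thr p n m - 2 * x by linarith)
  unfold valNext
  linarith

theorem gap_le (hp : 0 < p) (hm : 0 < m) (hS : 0 ≤ S) :
    m * gap p n m S ≤ 2 * m - 1 - n := by
  have hm' : (0 : ℝ) < m := by exact_mod_cast hm
  have h1 : m * gap p n m S = (2 * m - 1 - n) - S / (m * p) := by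
    unfold gap thr
    field_simp
  have : 0 ≤ S / (m * p) := by positivity
  linarith

/-- Raising a vertex of at least average height to the threshold. -/
theorem valNext_le_val (hp : 0 < p) (hm : 2 ≤ m) (hS : 0 ≤ S) {x : ℝ} (hx : S / m ≤ x)
    (hgap : 0 ≤ gap p n m S) : valNext p n m S x ≤ val p n m S + 8 * p := by
  refine (valNext_anti hp hx).trans ?_
  obtain ⟨a, rfl⟩ : ∃ a, m = a + 1 := ⟨m - 1, by omega⟩
  have ha : (1 : ℝ) ≤ a := by exact_mod_cast (show 1 ≤ a by omega)
  have ha0 : (a : ℝ) ≠ 0 := by positivity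
  have ha1 : (a : ℝ) + 1 ≠ 0 := by positivity
  set z := gap p n (a + 1) S with hz
  have hz2 : z ≤ 2 := by
    have := gap_le (n := n) hp (show 0 < a + 1 by omega) hS
    rw [← hz] at this
    push_cast at this
    have hn : (0 : ℝ) ≤ n := by positivity
    nlinarith
  have h1 : 2 * (thr p n (a + 1) - S / (a + 1 : ℕ)) = p * (2 * (a + 1) * z) := by
    rw [hz]
    unfold gap
    push_cast
    field_simp
  have h2 : gap p n a (S + thr p n (a + 1) - 2 * (S / (a + 1 : ℕ))) ≤ z - 2 / a := by
    have h3 : gap p n a (S + thr p n (a + 1) - 2 * (S / (a + 1 : ℕ))) =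
        z - 2 / a - z / a ^ 2 := by
      rw [hz]
      unfold gap thr
      push_cast
      field_simp
      ring
    rw [h3]
    have : 0 ≤ z / a ^ 2 := by positivity
    linarith
  unfold valNext val
  rw [h1, Nat.add_sub_cancel, ← hz, max_eq_left hgap]
  have h4 : psi (max (gap p n a (S + thr p n (a + 1) - 2 * (S / (a + 1 : ℕ)))) 0) ≤
      psi (max (z - 2 / a) 0) := psi_mono (le_max_right _ _) (max_le_max_right _ h2)
  have h5 : 2 * (a + 1) * z + a ^ 2 * psi (max (z - 2 / a) 0) ≤ (a + 1) ^ 2 * psi z + 8 := by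
    have h6 := psi_nonneg z
    rcases le_total (z - 2 / a) 0 with h | h
    · have h7 : z * a ≤ 2 := by
        have : z ≤ 2 / a := by linarith
        rwa [le_div_iff₀ (by linarith)] at this
      have h8 : psi 0 = 0 := by simp [psi]
      rw [max_eq_right h, h8]
      nlinarith
    · rw [max_eq_left h]
      have h7 := psi_add_le hgap (show 0 ≤ z + -(2 / a) by linarith)
      have h8 := mul_le_mul_of_nonneg_left h7 (show (0 : ℝ) ≤ a ^ 2 by positivity)
      have h9 : (a : ℝ) ^ 2 * (psi z + -(2 / a) * (1 - Real.exp (-z)) + (-(2 / a)) ^ 2) =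
          a ^ 2 * psi z - 2 * a * (1 - Real.exp (-z)) + 4 := by
        field_simp
        ring
      rw [h9, ← sub_eq_add_neg] at h8
      -- The differential equation `ψ + ψ' = z`: it cancels the terms linear in `a`, leaving a
      -- bounded error.
      have h10 : z = psi z + (1 - Real.exp (-z)) := by unfold psi; ring
      nlinarith
  have h6 := mul_le_mul_of_nonneg_left h5 hp.le
  have h7 := mul_le_mul_of_nonneg_left h4 (show 0 ≤ p * (a : ℝ) ^ 2 by positivity)
  rw [Nat.cast_add_one] at h7 ⊢
  linarith

/-- A firing does not increase `val` significantly. -/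
theorem val_fire_le (hp : 0 < p) (hmn : m + 1 ≤ n) (hm : 1 ≤ m) {x : ℝ}
    (hx : thr p n (m + 1) ≤ x) (hx' : x ≤ thr p n n + 1) (hS : 0 ≤ S - x) (hS0 : 0 ≤ S) :
    val p n m (S - x) ≤ val p n (m + 1) S + (6 * p + 1) := by
  have hm1 : (1 : ℝ) ≤ m := by exact_mod_cast hm
  have hmn' : (m : ℝ) + 1 ≤ n := by exact_mod_cast hmn
  have hv0 := val_nonneg (n := n) (m := m + 1) (S := S) hp
  have hps0 : psi 0 = 0 := by simp [psi]
  rcases le_or_gt (2 * (m : ℝ) - 1 - n) 0 with hT | hT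
  · have h1 := gap_le (n := n) hp (show 0 < m by omega) hS
    have h2 : gap p n m (S - x) ≤ 0 := by nlinarith
    unfold val at *
    rw [max_eq_right h2, hps0]
    linarith
  -- Capping `x` at the initial threshold costs at most one turn and makes the excess over the
  -- current threshold a multiple `ω` of `p` with `ω ≤ 2(n - m - 1)`.
  obtain ⟨y, hy1, hy2, hy3, hy4⟩ : ∃ y, y ≤ x ∧ x ≤ y + 1 ∧ thr p n (m + 1) ≤ y ∧
      y ≤ thr p n n := by
    refine ⟨min x (thr p n n), min_le_left _ _, ?_, le_min hx (thr_mono hp.le n hmn),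
      min_le_right _ _⟩
    rcases min_cases x (thr p n n) with h | h <;> linarith
  have hval : val p n m (S - x) ≤ val p n m (S - y) + 1 := by
    have := val_le_add (n := n) (m := m) hp (show S - x ≤ S - y by linarith)
    linarith
  refine hval.trans ?_
  obtain ⟨ω, hω⟩ : ∃ ω, y = thr p n (m + 1) + p * ω :=
    ⟨(y - thr p n (m + 1)) / p, by field_simp; ring⟩
  have hω0 : 0 ≤ ω := by
    have : 0 ≤ p * ω := by linarith
    exact nonneg_of_mul_nonneg_right this hp
  have hω1 : ω ≤ 2 * (n - (m + 1)) := by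
    have h1 : thr p n n - thr p n (m + 1) = p * (2 * (n - (m + 1))) := by
      unfold thr; push_cast; ring
    exact le_of_mul_le_mul_left (by linarith) hp
  set z := gap p n (m + 1) S with hz
  have hz' : gap p n m (S - y) = ((m + 1) ^ 2 * z + ω - 2 * m) / m ^ 2 := by
    rw [hz, hω]
    unfold gap thr
    push_cast
    have : (m : ℝ) + 1 ≠ 0 := by positivity
    have : (m : ℝ) ≠ 0 := by positivity
    field_simp
    ring
  suffices h : (m : ℝ) ^ 2 * psi (max (gap p n m (S - y)) 0) ≤
      (m + 1) ^ 2 * psi (max z 0) + 6 by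
    have := mul_le_mul_of_nonneg_left h hp.le
    unfold val
    push_cast
    linarith
  have hpz := psi_nonneg (max z 0)
  rcases le_total (gap p n m (S - y)) 0 with hg | hg
  · rw [max_eq_right hg, hps0]
    nlinarith
  rw [max_eq_left hg]
  have hmsq : (0 : ℝ) < m ^ 2 := by positivity
  rcases le_total z 0 with hz0 | hz0
  · have h1 : gap p n m (S - y) ≤ 2 / m := by
      rw [hz', div_le_div_iff₀ hmsq (by linarith)]
      have h3 : (m + 1 : ℝ) ^ 2 * z ≤ 0 := mul_nonpos_of_nonneg_of_nonpos (by positivity) hz0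
      have h2 : (m + 1) ^ 2 * z + ω - 2 * m ≤ 2 * m := by linarith
      nlinarith
    have h2 := psi_le_sq hg
    have h3 : gap p n m (S - y) ^ 2 ≤ (2 / m) ^ 2 := by gcongr
    have h4 : (m : ℝ) ^ 2 * (2 / m) ^ 2 = 4 := by field_simp; norm_num
    have h5 := mul_le_mul_of_nonneg_left (h2.trans h3) hmsq.le
    nlinarith
  · rw [max_eq_left hz0] at hpz ⊢
    have h1 : (m + 1) * z ≤ 2 * m + 1 - n := by
      have := gap_le (n := n) hp (show 0 < m + 1 by omega) hS0
      rw [← hz] at this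
      push_cast at this
      linarith
    have hz2 : z ≤ 1 := by nlinarith
    set δ := (2 * m * z + z + ω - 2 * m) / (m : ℝ) ^ 2 with hδ
    have hgz : gap p n m (S - y) = z + δ := by
      rw [hz', hδ]
      field_simp
      ring
    rw [hgz] at hg ⊢
    have h2 := psi_add_le hz0 hg
    have h3 := mul_le_mul_of_nonneg_left h2 hmsq.le
    have hδ' : (m : ℝ) ^ 2 * δ = 2 * m * z + z + ω - 2 * m := by
      rw [hδ]; field_simp
    -- A large excess `ω` requires `n - m` large, but then `S ≥ 0` forces `z` to be small (`h1`);
    -- the two effects balance.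
    have hup : (m : ℝ) ^ 2 * δ ≤ 1 := by rw [hδ']; linarith
    have hlo : -(2 * m) ≤ (m : ℝ) ^ 2 * δ := by
      rw [hδ']
      have : 0 ≤ 2 * m * z := by positivity
      linarith
    have hsq : (m : ℝ) ^ 2 * δ ^ 2 ≤ 4 := by
      have h4 : ((m : ℝ) ^ 2 * δ) ^ 2 ≤ (2 * m) ^ 2 := by
        apply sq_le_sq'
        · exact hlo
        · linarith
      have h5 : (m : ℝ) ^ 2 * (m ^ 2 * δ ^ 2) ≤ m ^ 2 * 4 := by nlinarith
      exact le_of_mul_le_mul_left h5 hmsq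
    have he1 : Real.exp (-z) ≤ 1 := Real.exp_le_one_iff.mpr (by linarith)
    have he0 := Real.exp_pos (-z)
    have hlin : (m : ℝ) ^ 2 * δ * (1 - Real.exp (-z)) ≤ 1 := by nlinarith
    have : 0 ≤ (2 * (m : ℝ) + 1) * psi z := mul_nonneg (by positivity) hpz
    linarith

/-! ### Min's strategy: raise one target until a firing occurs -/

variable {V : Type*}

/-- The number of turns that suffices for Min, when `v` is the vertex that fires next. -/
noncomputable def turnBound (p : ℝ) (n : ℕ) (P : Player) (s : BrushPosition V) (v : V) : ℝ :=
  (8 * p + 5) * s.dirty.card + match P with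
    | .min => valNext p n s.dirty.card (total p n s) (own p n s v)
    | .max => valNext p n s.dirty.card (total p n s + 1) (own p n s v) + 1

theorem turnBound_le (hp : 0 < p) (P : Player) (s : BrushPosition V) (v : V) :
    turnBound p n P s v ≤ (8 * p + 5) * s.dirty.card +
      valNext p n s.dirty.card (total p n s) (own p n s v) + 1 := by
  cases P
  · unfold turnBound
    dsimp only
    linarith
  · have := val_anti (n := n) (m := s.dirty.card - 1) hp
      (show total p n s + thr p n s.dirty.card - 2 * own p n s v ≤
        total p n s + 1 + thr p n s.dirty.card - 2 * own p n s v by linarith)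
    unfold turnBound valNext
    dsimp only
    linarith

/-- The vertex `u` that fires need not be the target `v`. Since `u` is within one brush of the
threshold and `v` is at most one above it, firing `u` instead costs at most 4 extra. -/
theorem val_le_turnBound (hp : 0 < p) (P : Player) {s : BrushPosition V} {u v : V}
    (hu : thr p n s.dirty.card ≤ own p n s u) (hu' : own p n s u ≤ thr p n s.dirty.card + 1)
    (hv' : own p n s v ≤ thr p n s.dirty.card + 1) :
    val p n (s.dirty.card - 1) (total p n s - own p n s u) + (8 * p + 5) * s.dirty.card ≤
      turnBound p n P s v + 4 := by
  have key : ∀ c : ℝ, 0 ≤ c → c ≤ 1 →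
      val p n (s.dirty.card - 1) (total p n s - own p n s u) ≤
      valNext p n s.dirty.card (total p n s + c) (own p n s v) + 4 := by
    intro c hc0 hc1
    have h1 := valNext_anti (n := n) (m := s.dirty.card) (S := total p n s + c) hp hv'
    have h2 := val_le_add (n := n) (m := s.dirty.card - 1) hp
      (show total p n s - own p n s u ≤ total p n s + c - thr p n s.dirty.card by linarith)
    have h3 := val_anti (n := n) (m := s.dirty.card - 1) hp
      (show total p n s + c + thr p n s.dirty.card - 2 * (thr p n s.dirty.card + 1) ≤
        total p n s + c - thr p n s.dirty.card by linarith)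
    have h4 : valNext p n s.dirty.card (total p n s + c) (thr p n s.dirty.card + 1) = -2 +
      val p n (s.dirty.card - 1)
        (total p n s + c + thr p n s.dirty.card - 2 * (thr p n s.dirty.card + 1)) := by
      unfold valNext; ring
    linarith
  cases P
  · have := key 0 le_rfl (by norm_num)
    rw [add_zero] at this
    unfold turnBound
    dsimp only
    linarith
  · have := key 1 (by norm_num) le_rfl
    unfold turnBound
    dsimp only
    linarith

variable [DecidableEq V] [DecidableRel (⊤ : SimpleGraph V).Adj]

/-- In a stable position with a dirty vertex, Min can choose a vertex to make fire next. -/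
theorem exists_valNext_le (hp : 0 < p) {s : BrushPosition V} (hs : ∀ v, ¬ s.Ready p ⊤ v)
    (hn : s.dirty.card ≤ n) (hown : ∀ v ∈ s.dirty, 0 ≤ own p n s v) (hne : s.dirty.Nonempty) :
    ∃ v ∈ s.dirty, valNext p n s.dirty.card (total p n s) (own p n s v) ≤
      val p n s.dirty.card (total p n s) + 8 * p := by
  have hpos : 0 < s.dirty.card := Finset.card_pos.mpr hne
  have hpos' : (0 : ℝ) < s.dirty.card := by exact_mod_cast hpos
  obtain ⟨v, hv, hav⟩ : ∃ v ∈ s.dirty, total p n s / s.dirty.card ≤ own p n s v := by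
    refine Finset.exists_le_of_sum_le hne ?_
    rw [Finset.sum_const, nsmul_eq_mul, mul_div_cancel₀ _ hpos'.ne']
    rfl
  have hlt : own p n s v < thr p n s.dirty.card := by
    by_contra h
    exact hs v (ready_top_iff.mpr ⟨hv, not_lt.mp h⟩)
  have hS : 0 ≤ total p n s := Finset.sum_nonneg hown
  -- A lone dirty vertex has threshold `p(1 - n) ≤ 0`, so it would already be ready.
  have h2 : 2 ≤ s.dirty.card := by
    by_contra h
    have h1 : s.dirty.card = 1 := by omega
    have h3 := hown v hv
    rw [h1] at hlt hn
    unfold thr at hlt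
    have : (1 : ℝ) ≤ n := by exact_mod_cast hn
    push_cast at hlt
    nlinarith
  refine ⟨v, hv, valNext_le_val hp h2 hS hav ?_⟩
  unfold gap
  exact div_nonneg (by linarith) (by positivity)

/-- If a firing takes place after a turn, then the bound is still good for the next vertex. -/
theorem exists_turnBound_stabilize_le (hp : 0 < p) (P : Player) {s : BrushPosition V} {v : V}
    (hn : s.dirty.card ≤ n) (hv : v ∈ s.dirty) (hown : ∀ w ∈ s.dirty, 0 ≤ own p n s w)
    (hown' : ∀ w ∈ s.dirty, own p n s w ≤ thr p n s.dirty.card + 1) :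
    (s.stabilize p ⊤).dirty.card ≤ n ∧
    (∀ w ∈ (s.stabilize p ⊤).dirty, 0 ≤ own p n (s.stabilize p ⊤) w) ∧
    ((s.stabilize p ⊤).dirty = ∅ ∨ ∃ w ∈ (s.stabilize p ⊤).dirty,
      turnBound p n P (s.stabilize p ⊤) w ≤ turnBound p n P s v) := by
  by_cases h : ∃ u, s.Ready p ⊤ u
  · rw [stabilize, dif_pos h]
    have hu := h.choose_spec
    set u := h.choose
    have hE : (0 : ℝ) < 8 * p + 5 := by linarith
    -- The first firing frees `8p + 5`: 4 pays for `val_le_turnBound`, and the spare `8p + 1` later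
    -- pays for the new target (`8p`) and for `turnBound_le` (`1`). Each further firing frees `8p +
    -- 5` again, enough for the `6p + 1` of `val_fire_le`.
    have hC : (s.fire p ⊤ u |>.stabilize p ⊤).dirty.card ≤ n ∧
        (∀ w ∈ (s.fire p ⊤ u |>.stabilize p ⊤).dirty,
          0 ≤ own p n (s.fire p ⊤ u |>.stabilize p ⊤) w ∧
          own p n (s.fire p ⊤ u |>.stabilize p ⊤) w ≤ thr p n n + 1) ∧
        val p n (s.fire p ⊤ u |>.stabilize p ⊤).dirty.card
          (total p n (s.fire p ⊤ u |>.stabilize p ⊤)) +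
          (8 * p + 5) * (s.fire p ⊤ u |>.stabilize p ⊤).dirty.card + 8 * p + 1 ≤
          turnBound p n P s v := by
      refine stabilize_induction (C := fun s' => s'.dirty.card ≤ n ∧
        (∀ w ∈ s'.dirty, 0 ≤ own p n s' w ∧ own p n s' w ≤ thr p n n + 1) ∧
        val p n s'.dirty.card (total p n s') + (8 * p + 5) * s'.dirty.card + 8 * p + 1 ≤
          turnBound p n P s v) ?_ _ ?_
      · rintro s' w ⟨h1, h2, h3⟩ hw
        obtain ⟨hwd, hwt⟩ := (ready_top_iff (n := n)).mp hw
        have hcard := card_dirty_fire (p := p) hwd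
        have hsub : ∀ w' ∈ (s'.fire p ⊤ w).dirty, w' ∈ s'.dirty := fun w' h =>
          Finset.mem_of_mem_erase h
        refine ⟨by omega, fun w' hw' => ?_, ?_⟩
        · rw [own_fire hwd hw']
          exact h2 w' (hsub w' hw')
        · have hS' : 0 ≤ total p n (s'.fire p ⊤ w) := Finset.sum_nonneg fun w' hw' => by
            rw [own_fire hwd hw']
            exact (h2 w' (hsub w' hw')).1
          have hS : 0 ≤ total p n s' := Finset.sum_nonneg fun w' hw' => (h2 w' hw').1
          rw [total_fire hwd] at hS' ⊢
          rw [← hcard] at hwt h3 h1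
          set a := (s'.fire p ⊤ w).dirty.card
          push_cast at h3
          rcases Nat.eq_zero_or_pos a with ha | ha
          · have := val_nonneg (n := n) (m := a + 1) (S := total p n s') hp
            have h4 : val p n a (total p n s' - own p n s' w) = 0 := by simp [val, ha]
            linarith
          · have := val_fire_le hp h1 ha hwt (h2 w hwd).2 hS' hS
            linarith
      · obtain ⟨hud, hut⟩ := (ready_top_iff (n := n)).mp hu
        have hcard := card_dirty_fire (p := p) hud
        refine ⟨by omega, fun w hw => ?_, ?_⟩
        · rw [own_fire hud hw]
          have hws : w ∈ s.dirty := Finset.mem_of_mem_erase hw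
          exact ⟨hown w hws, (hown' w hws).trans (by linarith [thr_mono hp.le n hn])⟩
        · rw [total_fire hud]
          have := val_le_turnBound hp P hut (hown' u hud) (hown' v hv)
          rw [← hcard, Nat.add_sub_cancel] at this
          push_cast at this
          linarith
    obtain ⟨h1, h2, h3⟩ := hC
    refine ⟨h1, fun w hw => (h2 w hw).1, ?_⟩
    rcases (s.fire p ⊤ u |>.stabilize p ⊤).dirty.eq_empty_or_nonempty with he | hne
    · exact Or.inl he
    · obtain ⟨w, hw, hval⟩ := exists_valNext_le hp (stabilize_spec p hp.le ⊤ _).1 h1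
        (fun w hw => (h2 w hw).1) hne
      have := turnBound_le (n := n) hp P (s.fire p ⊤ u |>.stabilize p ⊤) w
      exact Or.inr ⟨w, hw, by linarith⟩
  · rw [stabilize, dif_neg h]
    exact ⟨hn, hown, Or.inr ⟨v, hv, le_rfl⟩⟩

/-- Min plays on the target `v`, and `turnBound` at `v` drops by at least one with each turn of
either player; after a firing a new target is no worse. -/
theorem minForces_of_turnBound_le (hp : 0 < p) : ∀ (k : ℕ) (P : Player) (s : BrushPosition V),
    (∀ v, ¬ s.Ready p ⊤ v) → s.dirty.card ≤ n → (∀ v ∈ s.dirty, 0 ≤ own p n s v) →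
    (s.dirty = ∅ ∨ ∃ v ∈ s.dirty, turnBound p n P s v ≤ k) → MinForces p ⊤ k P s := by
  have hlt : ∀ s : BrushPosition V, (∀ v, ¬ s.Ready p ⊤ v) → ∀ v ∈ s.dirty,
      own p n s v < thr p n s.dirty.card := fun s hs v hv => by
    by_contra h
    exact hs v (ready_top_iff.mpr ⟨hv, not_lt.mp h⟩)
  have hplace : ∀ s : BrushPosition V, (∀ v, ¬ s.Ready p ⊤ v) →
      (∀ v ∈ s.dirty, 0 ≤ own p n s v) → ∀ w, ∀ v ∈ (s.place w).dirty,
      0 ≤ own p n (s.place w) v ∧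
      own p n (s.place w) v ≤ thr p n (s.place w).dirty.card + 1 := by
    intro s hs hown w v hv
    have h1 := hlt s hs v hv
    have h2 := hown v hv
    rw [own_place]
    change _ ∧ _ ≤ thr p n s.dirty.card + 1
    split_ifs <;> constructor <;> linarith
  intro k
  induction k with
  | zero =>
    rintro P s hs hn hown (h | ⟨v, hv, hk⟩)
    · exact h
    · have h1 := hlt s hs v hv
      have h2 : 0 < turnBound p n P s v := by
        have h3 : 0 ≤ (8 * p + 5) * (s.dirty.card : ℝ) := by positivity
        cases P
        · have := val_nonneg (n := n) (m := s.dirty.card - 1)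
            (S := total p n s + thr p n s.dirty.card - 2 * own p n s v) hp
          unfold turnBound valNext
          dsimp only
          linarith
        · have := val_nonneg (n := n) (m := s.dirty.card - 1)
            (S := total p n s + 1 + thr p n s.dirty.card - 2 * own p n s v) hp
          unfold turnBound valNext
          dsimp only
          linarith
      simp at hk
      linarith
  | succ k ih =>
    rintro P s hs hn hown (h | ⟨v, hv, hk⟩)
    · cases P <;> rw [MinForces] <;> exact Or.inl h
    push_cast at hk
    have hmove : ∀ w ∈ s.dirty, ∀ Q : Player, turnBound p n Q (s.place w) v ≤ k →
        MinForces p ⊤ k Q (s.move p ⊤ w) := by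
      intro w hw Q hQ
      have hpl := hplace s hs hown w
      obtain ⟨h1, h2, h3⟩ := exists_turnBound_stabilize_le hp Q (s := s.place w) (v := v) hn hv
        (fun u hu => (hpl u hu).1) (fun u hu => (hpl u hu).2)
      refine ih Q _ (stabilize_spec p hp.le ⊤ _).1 h1 h2 (h3.imp_right ?_)
      rintro ⟨u, hu, hub⟩
      exact ⟨u, hu, hub.trans hQ⟩
    cases P with
    | min =>
      rw [MinForces]
      refine Or.inr ⟨v, hv, hmove v hv .max ?_⟩
      unfold turnBound valNext at hk ⊢
      rw [total_place hv, own_place, if_pos rfl]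
      simp only [place]
      -- Min's brush on the target and the reply already credited to Max leave the total predicted
      -- after the firing unchanged.
      have : total p n s + 1 + 1 + thr p n s.dirty.card - 2 * (own p n s v + 1) =
          total p n s + thr p n s.dirty.card - 2 * own p n s v := by ring
      rw [this]
      dsimp only at hk
      linarith
    | max =>
      rw [MinForces]
      refine Or.inr fun w hw => hmove w hw .min ?_
      have h1 : own p n s v ≤ own p n (s.place w) v := by
        rw [own_place]
        split_ifs <;> linarith
      have h2 := valNext_anti (n := n) (m := s.dirty.card) (S := total p n s + 1) hp h1
      unfold turnBound at hk ⊢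
      rw [total_place hw]
      change (8 * p + 5) * (s.dirty.card : ℝ) + valNext p n s.dirty.card _ _ ≤ _
      dsimp only at hk
      linarith

theorem fractionalGameBrushNumber_top_le [Fintype V] (hp : 0 < p) (hn : Fintype.card V = n)
    (hn2 : 2 ≤ n) :
    (fractionalGameBrushNumber p (⊤ : SimpleGraph V) : ℝ) ≤
      p * n ^ 2 / Real.exp 1 + (8 * p + 5) * n + 8 * p + 2 := by
  set s : BrushPosition V := { dirty := Finset.univ, brushes := fun _ => 0 } with hs
  have hcard : s.dirty.card = n := hn
  have hown : ∀ v, own p n s v = 0 := fun v => by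
    unfold own
    rw [hcard]
    simp [hs]
  have hn1 : (2 : ℝ) ≤ n := by exact_mod_cast hn2
  have hready : ∀ v, ¬ s.Ready p ⊤ v := fun v hv => by
    have := ((ready_top_iff (n := n)).mp hv).2
    rw [hown, hcard] at this
    unfold thr at this
    nlinarith
  have hstart : start p (⊤ : SimpleGraph V) = s := by
    unfold start
    rw [stabilize, dif_neg]
    rintro ⟨v, hv⟩
    exact hready v hv
  have htotal : total p n s = 0 := Finset.sum_eq_zero fun v _ => hown v
  obtain ⟨v, hv, hval⟩ := exists_valNext_le hp hready hcard.le (fun v _ => (hown v).ge)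
    (Finset.card_pos.mp (by omega))
  have hbound : val p n n 0 ≤ p * n ^ 2 / Real.exp 1 := by
    have h1 : gap p n n 0 ≤ 1 := by
      have := gap_le (n := n) (S := 0) hp (show 0 < n by omega) le_rfl
      nlinarith
    have h2 : psi (max (gap p n n 0) 0) ≤ psi 1 :=
      psi_mono (le_max_right _ _) (max_le h1 zero_le_one)
    have h3 : psi 1 = 1 / Real.exp 1 := by
      unfold psi
      rw [Real.exp_neg]
      ring
    unfold val
    calc _ ≤ p * n ^ 2 * (1 / Real.exp 1) :=
          mul_le_mul_of_nonneg_left (h2.trans h3.le) (by positivity)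
      _ = _ := by ring
  have htb := turnBound_le (n := n) hp .min s v
  rw [htotal, hcard] at hval htb
  have hforce : MinForces p ⊤ ⌈turnBound p n .min s v⌉₊ .min (start p (⊤ : SimpleGraph V)) := by
    rw [hstart]
    exact minForces_of_turnBound_le hp _ _ s hready hcard.le (fun v _ => (hown v).ge)
      (Or.inr ⟨v, hv, Nat.le_ceil _⟩)
  have hle : fractionalGameBrushNumber p (⊤ : SimpleGraph V) ≤ ⌈turnBound p n .min s v⌉₊ :=
    Nat.sInf_le hforce
  have hle' : (fractionalGameBrushNumber p (⊤ : SimpleGraph V) : ℝ) ≤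
      ⌈p * n ^ 2 / Real.exp 1 + (8 * p + 5) * n + 8 * p + 1⌉₊ := by
    exact Nat.cast_le.mpr (hle.trans (Nat.ceil_mono (by linarith)))
  have := Nat.ceil_lt_add_one
    (show 0 ≤ p * n ^ 2 / Real.exp 1 + (8 * p + 5) * n + 8 * p + 1 by positivity)
  linarith

end Upper

end BrushPosition

/-! ### Asymptotics -/

open Filter Topology in
theorem tendsto_fractionalGameBrushNumber_top_div {p : ℕ → ℝ} (hp : ∀ n, 0 < p n)
    (hlim : Tendsto (fun n : ℕ => 1 / (n * p n)) atTop (𝓝 0)) :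
    Tendsto (fun n : ℕ => (fractionalGameBrushNumber (p n) (⊤ : SimpleGraph (Fin n)) : ℝ) /
      (p n * n ^ 2 / Real.exp 1)) atTop (𝓝 1) := by
  have hinv : Tendsto (fun n : ℕ => 1 / (n : ℝ)) atTop (𝓝 0) := tendsto_one_div_atTop_nhds_zero_nat
  -- The maximizer of `2 c² log (1 / c)`, with maximum `1 / e`; the lower bound is used with `q = ⌊c
  -- n⌋`.
  set c : ℝ := Real.exp (-(1 / 2)) with hc
  have hc0 : 0 < c := Real.exp_pos _
  have hc1 : c < 1 := Real.exp_lt_one_iff.mpr (by norm_num)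
  have hcc : c ^ 2 = 1 / Real.exp 1 := by
    rw [hc, ← Real.exp_nat_mul, one_div (Real.exp 1), ← Real.exp_neg]
    norm_num
  have hq : Tendsto (fun n : ℕ => (⌊c * n⌋₊ : ℝ) / n) atTop (𝓝 c) :=
    (tendsto_nat_floor_mul_div_atTop hc0.le).comp tendsto_natCast_atTop_atTop
  have he := (Real.exp_pos 1).ne'
  have hlower : Tendsto (fun n : ℕ => Real.exp 1 * (2 * ((⌊c * n⌋₊ : ℝ) / n *
      ((⌊c * n⌋₊ : ℝ) / n + 1 / n)) *
      Real.log ((1 + 2 * (1 / n)) / ((⌊c * n⌋₊ : ℝ) / n + 2 * (1 / n))) -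
      2 * (1 / (n * p n)) - 1 / (n * p n) * (1 / n))) atTop (𝓝 1) := by
    have hlog : Tendsto (fun n : ℕ => Real.log ((1 + 2 * (1 / n)) /
        ((⌊c * n⌋₊ : ℝ) / n + 2 * (1 / n)))) atTop (𝓝 (Real.log ((1 + 2 * 0) / (c + 2 * 0)))) := by
      refine Tendsto.log (Tendsto.div (tendsto_const_nhds.add (hinv.const_mul 2))
        (hq.add (hinv.const_mul 2)) ?_) ?_
      · simpa using hc0.ne'
      · simpa using hc0.ne'
    have := ((((hq.mul (hq.add hinv)).const_mul 2).mul hlog).sub (hlim.const_mul 2)).sub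
      (hlim.mul hinv) |>.const_mul (Real.exp 1)
    have hval : Real.exp 1 * (2 * (c * (c + 0)) * Real.log ((1 + 2 * 0) / (c + 2 * 0)) - 2 * 0 -
        0 * 0) = 1 := by
      have h1 : Real.log ((1 + 2 * 0) / (c + 2 * 0)) = 1 / 2 := by
        rw [mul_zero, add_zero, add_zero, one_div, Real.log_inv, hc, Real.log_exp]
        norm_num
      rw [h1]
      have : Real.exp 1 * (2 * (c * (c + 0)) * (1 / 2) - 2 * 0 - 0 * 0) = Real.exp 1 * c ^ 2 := by
        ring
      rw [this, hcc]
      field_simp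
    rwa [hval] at this
  have hupper : Tendsto (fun n : ℕ => 1 + Real.exp 1 * (8 * (1 / n) + 5 * (1 / (n * p n)) +
      8 * (1 / n * (1 / n)) + 2 * (1 / (n * p n) * (1 / n)))) atTop (𝓝 1) := by
    have := ((((hinv.const_mul 8).add (hlim.const_mul 5)).add ((hinv.mul hinv).const_mul 8)).add
      ((hlim.mul hinv).const_mul 2) |>.const_mul (Real.exp 1)).const_add 1
    simpa using this
  have hq1 : ∀ᶠ n : ℕ in atTop, 1 ≤ ⌊c * n⌋₊ := by
    have : Tendsto (fun n : ℕ => ⌊c * n⌋₊) atTop atTop :=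
      tendsto_nat_floor_atTop.comp (tendsto_natCast_atTop_atTop.const_mul_atTop hc0)
    exact this.eventually_ge_atTop 1
  refine tendsto_of_tendsto_of_tendsto_of_le_of_le' hlower hupper ?_ ?_
  · filter_upwards [hq1, eventually_ge_atTop 1] with n hqn hn
    have hn' : (0 : ℝ) < n := by exact_mod_cast hn
    have hpn := hp n
    have hle : ⌊c * n⌋₊ ≤ n := Nat.floor_le_of_le (by nlinarith)
    have h := BrushPosition.le_fractionalGameBrushNumber_top (V := Fin n) hpn.le
      (Fintype.card_fin n) hqn hle
    rw [le_div_iff₀ (by positivity)]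
    refine le_trans (le_of_eq ?_) h
    set q : ℝ := (⌊c * n⌋₊ : ℝ)
    have hq0 : 0 ≤ q := by positivity
    have hlog : (1 + 2 * (1 / (n : ℝ))) / (q / n + 2 * (1 / n)) = (n + 2) / (q + 2) := by
      field_simp
    rw [hlog]
    field_simp
  · filter_upwards [eventually_ge_atTop 2] with n hn
    have hn' : (0 : ℝ) < n := by exact_mod_cast (show 0 < n by omega)
    have hpn := hp n
    have h := BrushPosition.fractionalGameBrushNumber_top_le (V := Fin n) hpn
      (Fintype.card_fin n) hn
    rw [div_le_iff₀ (by positivity)]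
    refine h.trans (le_of_eq ?_)
    field_simp
    ring

theorem mainTheorem7 (p : ℕ → ℝ) (hp : ∀ n, 0 < p n)
    (hlog : Asymptotics.IsLittleO Filter.atTop (fun n : ℕ => Real.log n / n) p) :
    Asymptotics.IsEquivalent Filter.atTop
        (fun n : ℕ => (fractionalGameBrushNumber (p n) (⊤ : SimpleGraph (Fin n)) : ℝ))
        (fun n : ℕ => p n * (gameBrushNumber (⊤ : SimpleGraph (Fin n)) : ℝ)) ∧
      Asymptotics.IsEquivalent Filter.atTop
        (fun n : ℕ => (fractionalGameBrushNumber (p n) (⊤ : SimpleGraph (Fin n)) : ℝ))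
        (fun n : ℕ => p n * (n : ℝ) ^ 2 / Real.exp 1) := by
  have hlim : Filter.Tendsto (fun n : ℕ => 1 / (n * p n)) Filter.atTop (nhds 0) := by
    have h1 := hlog.tendsto_div_nhds_zero
    refine squeeze_zero' (Filter.Eventually.of_forall fun n => ?_) ?_ h1
    · have := hp n
      positivity
    -- From `n = 3` on, `log n ≥ 1`, so `1 / (n p)` is at most `log n / (n p)`.
    · filter_upwards [Filter.eventually_ge_atTop 3] with n hn
      have hn' : (3 : ℝ) ≤ n := by exact_mod_cast hn
      have hpn := hp n
      have h2 : 1 ≤ Real.log n := by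
        rw [Real.le_log_iff_exp_le (by linarith)]
        linarith [Real.exp_one_lt_d9]
      rw [div_div]
      gcongr
  have key : ∀ r : ℕ → ℝ, (∀ n, 0 < r n) →
      Filter.Tendsto (fun n : ℕ => 1 / (n * r n)) Filter.atTop (nhds 0) →
      Asymptotics.IsEquivalent Filter.atTop
        (fun n : ℕ => (fractionalGameBrushNumber (r n) (⊤ : SimpleGraph (Fin n)) : ℝ))
        (fun n : ℕ => r n * (n : ℝ) ^ 2 / Real.exp 1) := by
    intro r hr hr'
    rw [Asymptotics.isEquivalent_iff_tendsto_one]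
    · exact tendsto_fractionalGameBrushNumber_top_div hr hr'
    · filter_upwards [Filter.eventually_ge_atTop 1] with n hn
      have hn' : (0 : ℝ) < n := by exact_mod_cast hn
      have hrn := hr n
      positivity
  refine ⟨(key p hp hlim).trans ?_, key p hp hlim⟩
  have h1 := (key (fun _ => 1) (fun _ => one_pos)
    (by simpa using tendsto_one_div_atTop_nhds_zero_nat (𝕜 := ℝ))).symm
  have h2 := (Asymptotics.IsEquivalent.refl (u := p) (l := Filter.atTop)).mul h1
  refine h2.congr_left (Filter.Eventually.of_forall fun n => ?_)
  simp only [Pi.mul_apply]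
  ring
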